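/- For an integer $k\ge 1$ let $\eta(k)=\sum_{n\ge1}\frac{(-1)^{n-1}}{n^k}$ be the Dirichlet eta function, and let $\zeta$ be the Riemann zeta function. Then $$\zeta(3)=\frac{2}{7}\pi^2\Bigl(\frac14+\sum_{j=1}^{\infty}\frac{1}{(2j+1)(2j+2)}\,\eta(2j)\Bigr) =\frac{2}{7}\pi^2\Bigl(\frac38+\sum_{j=1}^{\infty}\frac{2j+3}{2^{2j+1}(2j+1)(2j+2)}\,\eta(2j)\Bigr),$$ where both series converge. The second series converges rapidly: with $$S_N=\frac{2}{7}\pi^2\Bigl(\frac38+\sum_{j=1}^{N}\frac{2j+3}{2^{2j+1}(2j+1)(2j+2)}\,\eta(2j)\Bigr),$$ one has $|\zeta(3)-S_N|\le 4^{-(N+1)}$ for every integer $N\ge 0$. Ten terms give $\zeta(3)$ to seven decimal places, $|\zeta(3)-S_{10}|<\frac12\cdot10^{-7}$, which is comparable to about $5000$ terms of the series $\sum_{j\ge 1} 1/j^3$: with $H_N=\sum_{j=1}^{N}1/j^3$, $$|\zeta(3)-H_{5050}|\le|\zeta(3)-S_{10}|\le|\zeta(3)-H_{5000}|.$$ -/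

import Mathlib

open scoped Real

/-- The Dirichlet eta function at the positive integer `k`:
`η(k) = ∑_{n ≥ 1} (-1)^(n-1) / n^k`, summed in the natural order, so that the conditionally
convergent case `k = 1` is included. (The value at `k = 0`, where the series diverges, is
irrelevant.) The summation index `n` below is shifted by one. -/
noncomputable def dirichletEta (k : ℕ) : ℝ :=
  ∑'[SummationFilter.conditional ℕ] n : ℕ, (-1 : ℝ) ^ n / ((n : ℝ) + 1) ^ k

/-- For `k ≥ 2` the series that defines `η(k)` converges absolutely, and its sum is `η(k)`. -/
theorem hasSum_dirichletEta {k : ℕ} (hk : 2 ≤ k) :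
    HasSum (fun n : ℕ => (-1 : ℝ) ^ n / ((n : ℝ) + 1) ^ k) (dirichletEta k) := by
  have h1 : Summable (fun n : ℕ => 1 / ((n : ℝ) + 1) ^ k) := by
    have h := (summable_nat_add_iff 1).2 (Real.summable_one_div_nat_pow.2 (by omega : 1 < k))
    simpa using h
  have h2 : Summable (fun n : ℕ => (-1 : ℝ) ^ n / ((n : ℝ) + 1) ^ k) := by
    refine Summable.of_norm_bounded h1 (fun n => ?_)
    rw [norm_div, norm_pow, norm_neg, norm_one, one_pow, Real.norm_of_nonneg (by positivity)]
  have h3 : HasSum (fun n : ℕ => (-1 : ℝ) ^ n / ((n : ℝ) + 1) ^ k)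
      (∑' n : ℕ, (-1 : ℝ) ^ n / ((n : ℝ) + 1) ^ k)
      (SummationFilter.conditional ℕ) := 
    h2.hasSum.mono_left SummationFilter.LeAtTop.le_atTop
  have h4 : dirichletEta k = ∑' n : ℕ, (-1 : ℝ) ^ n / ((n : ℝ) + 1) ^ k := h3.tsum_eq
  rw [h4]
  exact h2.hasSum

/-- The `j`-th term of the first series. -/
noncomputable def slowTerm (j : ℕ) : ℝ :=
  1 / ((2 * (j : ℝ) + 1) * (2 * (j : ℝ) + 2)) * dirichletEta (2 * j)

/-- The `j`-th term of the second, rapidly convergent series. -/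
noncomputable def rapidTerm (j : ℕ) : ℝ :=
  (2 * (j : ℝ) + 3) / (2 ^ (2 * j + 1) * (2 * (j : ℝ) + 1) * (2 * (j : ℝ) + 2)) *
    dirichletEta (2 * j)

/-- The approximation to `ζ(3)` given by the first `N` terms of the second series. -/
noncomputable def rapidApprox (N : ℕ) : ℝ :=
  2 / 7 * π ^ 2 * (3 / 8 + ∑ j ∈ Finset.Icc 1 N, rapidTerm j)

/-- The `N`-th partial sum of the defining series of `ζ(3)`. -/
noncomputable def zetaThreePartial (N : ℕ) : ℝ :=
  ∑ j ∈ Finset.Icc 1 N, 1 / (j : ℝ) ^ 3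

/-! Both series come from integrating one generating function. The partial fractions of the
cotangent give `∑ ζ(2j) x^(2j) = (1 - πx cot πx) / 2` on `(0, 1)`. Since `η(k) = ζ(k) - 2 ζ(k) /
2^k` and `cot (t/2) - cot t = 1 / sin t`, it follows that `∑ η(2j) x^(2j) = (πx / sin πx - 1) / 2`.
Multiplying by `1 - x` and integrating over `[0, b]` gives the first series for `b = 1` and half of
the second for `b = 1/2` (`hasSum_dirichletEta_integral`).

What remains is the integral of `πx(1 - x) / sin πx`. Over `[0, 1]`, expanding `1 / sin` in odd
sines and applying Riemann-Lebesgue gives `8/π² ∑ 1/(2k+1)^3 = 7ζ(3)/π²` (`integral_sinKernel`). The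
integrand is symmetric about `1/2`, so `[0, 1/2]` contributes exactly half.

All terms of the second series are nonnegative, so its errors are tails, controlled by `1 - 2^(-k) ≤
η(k) ≤ 1` and geometric series. The tails of `∑ 1/j^3` are compared with telescoping sums. -/

theorem HasSum.of_eq {ι : Type*} {f g : ι → ℝ} {a b : ℝ} (h : HasSum f a)
    (hfg : ∀ i, g i = f i) (hab : b = a) : HasSum g b := by
  rw [hab, funext hfg]
  exact h

/-! ### Zeta and eta values -/

/-- For `k ≥ 2` the sum `∑_{n ≥ 1} 1 / n ^ k`, as a real number. -/
noncomputable def realZeta (k : ℕ) : ℝ := ∑' n : ℕ, 1 / ((n : ℝ) + 1) ^ k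

theorem summable_one_div_succ_pow {k : ℕ} (hk : 2 ≤ k) :
    Summable (fun n : ℕ => 1 / ((n : ℝ) + 1) ^ k) := by
  have h := (summable_nat_add_iff 1).2 (Real.summable_one_div_nat_pow.2 (by omega : 1 < k))
  simpa using h

theorem hasSum_realZeta {k : ℕ} (hk : 2 ≤ k) :
    HasSum (fun n : ℕ => 1 / ((n : ℝ) + 1) ^ k) (realZeta k) :=
  (summable_one_div_succ_pow hk).hasSum

theorem hasSum_even_realZeta {k : ℕ} (hk : 2 ≤ k) :
    HasSum (fun n : ℕ => 1 / (2 * (n : ℝ) + 2) ^ k) (realZeta k / 2 ^ k) := by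
  refine ((hasSum_realZeta hk).div_const (2 ^ k)).of_eq (fun n => ?_) rfl
  rw [div_div, ← mul_pow]
  ring

theorem hasSum_odd_realZeta {k : ℕ} (hk : 2 ≤ k) :
    HasSum (fun n : ℕ => 1 / (2 * (n : ℝ) + 1) ^ k) (realZeta k - realZeta k / 2 ^ k) := by
  have hs : Summable (fun n : ℕ => 1 / (2 * (n : ℝ) + 1) ^ k) := by
    have := (summable_one_div_succ_pow hk).comp_injective
      (mul_right_injective₀ (two_ne_zero' ℕ))
    simpa [Function.comp_def] using this
  have h := HasSum.even_add_odd (f := fun n : ℕ => 1 / ((n : ℝ) + 1) ^ k)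
    (by simpa using hs.hasSum)
    ((hasSum_even_realZeta hk).of_eq (fun n => by push_cast; ring) rfl)
  exact hs.hasSum.of_eq (fun _ => rfl) (by
    have := h.unique (hasSum_realZeta hk)
    simp only [← one_div] at this
    linarith)

theorem dirichletEta_eq_realZeta {k : ℕ} (hk : 2 ≤ k) :
    dirichletEta k = realZeta k - 2 * (realZeta k / 2 ^ k) := by
  have h := HasSum.even_add_odd (f := fun n : ℕ => (-1 : ℝ) ^ n / ((n : ℝ) + 1) ^ k)
    (by simpa using hasSum_odd_realZeta hk)
    ((hasSum_even_realZeta hk).neg.of_eq (fun n => by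
      rw [pow_succ, pow_mul]
      push_cast
      norm_num
      rw [neg_div, add_assoc]
      norm_num) rfl)
  rw [(hasSum_dirichletEta hk).unique h]
  ring

theorem riemannZeta_three_eq : riemannZeta 3 = (realZeta 3 : ℂ) := by
  have h := zeta_eq_tsum_one_div_nat_add_one_cpow (s := 3) (by norm_num)
  rw [h, realZeta, Complex.ofReal_tsum]
  refine tsum_congr fun n => ?_
  push_cast
  norm_cast

/-- The alternating series bounds for `η`. -/
theorem dirichletEta_bounds {k : ℕ} (hk : 2 ≤ k) :
    1 - 1 / 2 ^ k ≤ dirichletEta k ∧ dirichletEta k ≤ 1 := by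
  have ha : Antitone (fun n : ℕ => 1 / ((n : ℝ) + 1) ^ k) := by
    intro a b hab
    have : (a : ℝ) ≤ b := by exact_mod_cast hab
    dsimp only
    gcongr
  have ht : Filter.Tendsto (fun N => ∑ i ∈ Finset.range N, (-1 : ℝ) ^ i * (1 / ((i : ℝ) + 1) ^ k))
      Filter.atTop (nhds (dirichletEta k)) := by
    simpa only [mul_one_div] using (hasSum_dirichletEta hk).tendsto_sum_nat
  have h1 := ha.alternating_series_le_tendsto ht 1
  have h2 := ha.tendsto_le_alternating_series ht 0
  simp [Finset.sum_range_succ] at h1 h2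
  norm_num at h1 h2
  refine ⟨?_, h2⟩
  simp only [one_div]
  linarith

theorem dirichletEta_nonneg {k : ℕ} (hk : 2 ≤ k) : 0 ≤ dirichletEta k := by
  have h := (dirichletEta_bounds hk).1
  have : 1 / (2 : ℝ) ^ k ≤ 1 := by
    rw [div_le_one (by positivity)]
    exact one_le_pow₀ (by norm_num)
  linarith

/-! ### Generating functions of the even zeta and eta values -/

theorem pi_mul_cot_pi_mul_eq_tsum {x : ℝ} (hx0 : 0 < x) (hx1 : x < 1) :
    ∑' n : ℕ, x ^ 2 / (((n : ℝ) + 1) ^ 2 - x ^ 2) = (1 - π * x * Real.cot (π * x)) / 2 := by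
  have hxZ : (x : ℂ) ∈ Complex.integerComplement := by
    rintro ⟨m, hm⟩
    have hm' : (m : ℝ) = x := by exact_mod_cast hm
    have h0 : (0 : ℝ) < m := hm' ▸ hx0
    have h1 : (m : ℝ) < 1 := hm' ▸ hx1
    norm_cast at h0 h1
    omega
  have key : π * Real.cot (π * x) - 1 / x =
      ∑' n : ℕ, (1 / (x - (n + 1)) + 1 / (x + (n + 1))) := by
    apply Complex.ofReal_injective
    rw [Complex.ofReal_tsum]
    push_cast
    exact cot_series_rep' hxZ
  have hval : ∑' n : ℕ, (1 / (x - (n + 1)) + 1 / (x + (n + 1))) =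
      -2 / x * ∑' n : ℕ, x ^ 2 / (((n : ℝ) + 1) ^ 2 - x ^ 2) := by
    rw [← tsum_mul_left]
    refine tsum_congr fun n => ?_
    have h1 : (1 : ℝ) ≤ n + 1 := by linarith [Nat.cast_nonneg (α := ℝ) n]
    have e1 : x - (n + 1) ≠ 0 := by linarith
    have e2 : x + (n + 1) ≠ 0 := by linarith
    have e3 : ((n : ℝ) + 1) ^ 2 - x ^ 2 ≠ 0 := by nlinarith
    rw [div_add_div _ _ e1 e2, div_mul_div_comm,
      div_eq_div_iff (mul_ne_zero e1 e2) (mul_ne_zero hx0.ne' e3)]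
    ring
  rw [hval] at key
  field_simp at key
  linarith

theorem summable_pow_div_succ_pow {x : ℝ} (hx0 : 0 < x) (hx1 : x < 1) :
    Summable fun p : ℕ × ℕ => 1 / ((p.1 : ℝ) + 1) ^ (2 * p.2 + 2) * x ^ (2 * p.2 + 2) := by
  have hx2 : x ^ 2 < 1 := by nlinarith
  refine Summable.of_nonneg_of_le (fun p => by positivity) (fun p => ?_)
    ((summable_one_div_succ_pow le_rfl).mul_of_nonneg
      (summable_geometric_of_lt_one (sq_nonneg x) hx2)
      (fun n => by positivity) (fun j => by positivity))
  have h1 : (1 : ℝ) ≤ p.1 + 1 := by linarith [Nat.cast_nonneg (α := ℝ) p.1]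
  gcongr ?_ * ?_
  · exact one_div_le_one_div_of_le (by positivity) (pow_le_pow_right₀ h1 (by omega))
  · rw [← pow_mul]
    exact pow_le_pow_of_le_one hx0.le hx1.le (by omega)

theorem hasSum_pow_div_succ_pow {x : ℝ} (hx0 : 0 < x) (hx1 : x < 1) (n : ℕ) :
    HasSum (fun j : ℕ => 1 / ((n : ℝ) + 1) ^ (2 * j + 2) * x ^ (2 * j + 2))
      (x ^ 2 / (((n : ℝ) + 1) ^ 2 - x ^ 2)) := by
  have h1 : (1 : ℝ) ≤ n + 1 := by linarith [Nat.cast_nonneg (α := ℝ) n]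
  have hq : (x / (n + 1)) ^ 2 < 1 := by
    rw [div_pow, div_lt_one (by positivity)]
    nlinarith
  have := (hasSum_geometric_of_lt_one (sq_nonneg _) hq).mul_left ((x / (n + 1)) ^ 2)
  refine this.of_eq (fun j => ?_) ?_
  · rw [← pow_mul, ← pow_add, div_pow]
    ring
  · have : ((n : ℝ) + 1) ^ 2 - x ^ 2 ≠ 0 := by nlinarith
    field_simp

/-- Each partial fraction of the cotangent is a geometric series in `(x / (n + 1))^2`; the
absolutely convergent double series is then summed in the other order. -/
theorem hasSum_realZeta_mul_pow {x : ℝ} (hx0 : 0 < x) (hx1 : x < 1) :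
    HasSum (fun j : ℕ => realZeta (2 * j + 2) * x ^ (2 * j + 2))
      ((1 - π * x * Real.cot (π * x)) / 2) := by
  have hf := summable_pow_div_succ_pow hx0 hx1
  have h1 := hf.hasSum.prod_fiberwise (hasSum_pow_div_succ_pow hx0 hx1)
  have h2 := hf.prod_symm.hasSum.prod_fiberwise
    (fun j => (hasSum_realZeta (k := 2 * j + 2) (by omega)).mul_right (x ^ (2 * j + 2)))
  refine h2.of_eq (fun _ => rfl) ?_
  rw [← pi_mul_cot_pi_mul_eq_tsum hx0 hx1, h1.tsum_eq]
  exact ((Equiv.prodComm ℕ ℕ).tsum_eq _).symm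

theorem hasSum_dirichletEta_mul_pow {x : ℝ} (hx0 : 0 < x) (hx1 : x < 1) :
    HasSum (fun j : ℕ => dirichletEta (2 * j + 2) * x ^ (2 * j + 2))
      ((π * x / Real.sin (π * x) - 1) / 2) := by
  have h := (hasSum_realZeta_mul_pow hx0 hx1).sub
    ((hasSum_realZeta_mul_pow (x := x / 2) (by linarith) (by linarith)).mul_left 2)
  refine h.of_eq (fun j => ?_) ?_
  · rw [dirichletEta_eq_realZeta (by omega), div_pow]
    ring
  · have hs : 0 < Real.sin (π * (x / 2)) :=
      Real.sin_pos_of_pos_of_lt_pi (by positivity) (by nlinarith [Real.pi_pos])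
    have hc : 0 < Real.cos (π * (x / 2)) :=
      Real.cos_pos_of_mem_Ioo ⟨by nlinarith [Real.pi_pos], by nlinarith [Real.pi_pos]⟩
    generalize ht : π * (x / 2) = t at hs hc ⊢
    rw [show π * x = 2 * t by rw [← ht]; ring, Real.cot_eq_cos_div_sin, Real.cot_eq_cos_div_sin,
      Real.sin_two_mul, Real.cos_two_mul]
    have hs' := hs.ne'
    have hc' := hc.ne'
    field_simp
    ring

/-! ### The integral of `πx(1 - x) / sin πx` -/

open MeasureTheory Filter intervalIntegral

/-- The integrand `(1 - x) · πx / sin(πx)`. -/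
noncomputable def sinKernel (x : ℝ) : ℝ := (1 - x) * (π * x / Real.sin (π * x))

theorem sinKernel_one_sub (x : ℝ) : sinKernel (1 - x) = sinKernel x := by
  rw [sinKernel, sinKernel, show π * (1 - x) = π - π * x by ring, Real.sin_pi_sub]
  ring

theorem measurable_sinKernel : Measurable sinKernel := by
  unfold sinKernel
  fun_prop

theorem sin_pi_mul_pos {x : ℝ} (hx : x ∈ Set.Ioo (0 : ℝ) 1) : 0 < Real.sin (π * x) :=
  Real.sin_pos_of_pos_of_lt_pi (mul_pos Real.pi_pos hx.1) (by nlinarith [Real.pi_pos, hx.2])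

theorem sinKernel_nonneg {x : ℝ} (hx : x ∈ Set.Ioo (0 : ℝ) 1) : 0 ≤ sinKernel x :=
  mul_nonneg (by linarith [hx.2])
    (div_nonneg (mul_nonneg Real.pi_pos.le hx.1.le) (sin_pi_mul_pos hx).le)

theorem sinKernel_le {x : ℝ} (hx : x ∈ Set.Ioo (0 : ℝ) 1) : sinKernel x ≤ π := by
  wlog h : x ≤ 1 / 2 generalizing x
  · rw [← sinKernel_one_sub]
    exact this ⟨by linarith [hx.2], by linarith [hx.1]⟩ (by linarith)
  -- Jordan's inequality `sin t ≥ 2t/π`, valid only up to `t = π/2`, hence the reduction by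
  -- symmetry.
  have hs := Real.mul_le_sin (x := π * x) (mul_nonneg Real.pi_pos.le hx.1.le)
    (by nlinarith [Real.pi_pos])
  have e : 2 / π * (π * x) = 2 * x := by field_simp
  rw [e] at hs
  have h1 : π * x / Real.sin (π * x) ≤ π := by
    rw [div_le_iff₀ (sin_pi_mul_pos hx)]
    nlinarith [Real.pi_pos, hx.1]
  have h2 : 0 ≤ π * x / Real.sin (π * x) :=
    div_nonneg (mul_nonneg Real.pi_pos.le hx.1.le) (sin_pi_mul_pos hx).le
  rw [sinKernel]
  nlinarith [hx.1]

theorem integrableOn_sinKernel : IntegrableOn sinKernel (Set.Ioo 0 1) := by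
  refine Measure.integrableOn_of_bounded (M := π) (by simp)
    measurable_sinKernel.aestronglyMeasurable ?_
  refine (ae_restrict_iff' measurableSet_Ioo).2 (Eventually.of_forall fun x hx => ?_)
  rw [Real.norm_of_nonneg (sinKernel_nonneg hx)]
  exact sinKernel_le hx

theorem intervalIntegrable_sinKernel : IntervalIntegrable sinKernel volume 0 1 := by
  rw [intervalIntegrable_iff_integrableOn_Ioo_of_le zero_le_one]
  exact integrableOn_sinKernel

theorem integral_sinKernel_eq_two_mul :
    ∫ x in (0 : ℝ)..1, sinKernel x = 2 * ∫ x in (0 : ℝ)..(1 / 2), sinKernel x := by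
  have hi := intervalIntegrable_sinKernel
  have h1 : IntervalIntegrable sinKernel volume 0 (1 / 2) :=
    hi.mono_set (by
      rw [Set.uIcc_of_le (by norm_num), Set.uIcc_of_le (by norm_num)]
      exact Set.Icc_subset_Icc le_rfl (by norm_num))
  have h2 : IntervalIntegrable sinKernel volume (1 / 2) 1 :=
    hi.mono_set (by
      rw [Set.uIcc_of_le (by norm_num), Set.uIcc_of_le (by norm_num)]
      exact Set.Icc_subset_Icc (by norm_num) le_rfl)
  rw [← integral_add_adjacent_intervals h1 h2, two_mul]
  congr 1
  have := integral_comp_sub_left (a := 0) (b := 1 / 2) sinKernel 1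
  simp only [sinKernel_one_sub] at this
  rw [this]
  norm_num

/-- Divided by `sin t`, this expands `1 / sin t` in odd sines with remainder `cos (2Kt) / sin t`. -/
theorem sin_mul_sum_sin_odd (t : ℝ) (K : ℕ) :
    2 * Real.sin t * ∑ k ∈ Finset.range K, Real.sin ((2 * k + 1) * t) =
      1 - Real.cos (2 * K * t) := by
  induction K with
  | zero => simp
  | succ K ih =>
    rw [Finset.sum_range_succ, mul_add, ih]
    push_cast
    rw [show 2 * (K : ℝ) * t = (2 * K + 1) * t - t by ring,
      show 2 * ((K : ℝ) + 1) * t = (2 * K + 1) * t + t by ring, Real.cos_sub, Real.cos_add]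
    ring

theorem integral_mul_one_sub_mul_sin (k : ℕ) :
    ∫ x in (0 : ℝ)..1, x * (1 - x) * Real.sin ((2 * k + 1) * (π * x)) =
      4 / ((2 * k + 1) * π) ^ 3 := by
  set a : ℝ := (2 * k + 1) * π with ha
  have ha0 : a ≠ 0 := by positivity
  -- The antiderivative results from integrating by parts twice.
  have hd : ∀ x ∈ Set.uIcc (0 : ℝ) 1, HasDerivAt
      (fun x => -(x * (1 - x)) * Real.cos (a * x) / a + (1 - 2 * x) * Real.sin (a * x) / a ^ 2
        - 2 * Real.cos (a * x) / a ^ 3)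
      (x * (1 - x) * Real.sin ((2 * k + 1) * (π * x))) x := by
    intro x _
    have hl : HasDerivAt (fun x : ℝ => a * x) a x := by
      simpa using (hasDerivAt_id x).const_mul a
    have hq : HasDerivAt (fun x : ℝ => -(x * (1 - x))) (-(1 * (1 - x) + x * (-1))) x :=
      ((hasDerivAt_id x).mul ((hasDerivAt_id x).const_sub 1)).neg
    have hm : HasDerivAt (fun x : ℝ => 1 - 2 * x) (-(2 * 1)) x :=
      ((hasDerivAt_id x).const_mul 2).const_sub 1
    have := (((hq.mul hl.cos).div_const a).add ((hm.mul hl.sin).div_const (a ^ 2))).sub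
      ((hl.cos.const_mul 2).div_const (a ^ 3))
    refine this.congr_deriv ?_
    rw [show (2 * (k : ℝ) + 1) * (π * x) = a * x by rw [ha]; ring]
    field_simp
    ring
  rw [integral_eq_sub_of_hasDerivAt hd (by apply Continuous.intervalIntegrable; fun_prop)]
  have hc : Real.cos a = -1 := by
    rw [ha, show (2 * (k : ℝ) + 1) * π = π + k * (2 * π) by ring,
      Real.cos_add_nat_mul_two_pi, Real.cos_pi]
  have hs : Real.sin a = 0 := by
    rw [ha, show (2 * (k : ℝ) + 1) * π = π + k * (2 * π) by ring,
      Real.sin_add_nat_mul_two_pi, Real.sin_pi]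
  simp [hc, hs]
  ring

theorem integral_sinKernel_eq_sum_add (K : ℕ) :
    ∫ x in (0 : ℝ)..1, sinKernel x =
      8 / π ^ 2 * ∑ k ∈ Finset.range K, 1 / (2 * (k : ℝ) + 1) ^ 3 +
        ∫ x in (0 : ℝ)..1, Real.cos (2 * π * (x * K)) * sinKernel x := by
  have hpt : ∫ x in (0 : ℝ)..1, sinKernel x =
      ∫ x in (0 : ℝ)..1, ((∑ k ∈ Finset.range K,
        2 * π * (x * (1 - x) * Real.sin ((2 * k + 1) * (π * x)))) +
          Real.cos (2 * π * (x * K)) * sinKernel x) := by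
    rw [integral_of_le zero_le_one, integral_of_le zero_le_one, integral_Ioc_eq_integral_Ioo,
      integral_Ioc_eq_integral_Ioo]
    refine setIntegral_congr_fun measurableSet_Ioo fun x hx => ?_
    have hs := (sin_pi_mul_pos hx).ne'
    have h := sin_mul_sum_sin_odd (π * x) K
    simp only [← Finset.mul_sum]
    rw [show 2 * π * (x * (K : ℝ)) = 2 * K * (π * x) by ring, sinKernel]
    generalize (∑ k ∈ Finset.range K, Real.sin ((2 * (k : ℝ) + 1) * (π * x))) = S at h ⊢
    generalize Real.cos (2 * K * (π * x)) = c at h ⊢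
    generalize Real.sin (π * x) = s at h hs ⊢
    field_simp
    linear_combination (x - 1) * x * h
  have hi : IntervalIntegrable (fun x => Real.cos (2 * π * (x * K)) * sinKernel x) volume 0 1 :=
    intervalIntegrable_sinKernel.continuousOn_mul (by fun_prop)
  rw [hpt, integral_add (by apply Continuous.intervalIntegrable; fun_prop) hi,
    intervalIntegral.integral_finsetSum (fun k _ => by apply Continuous.intervalIntegrable; fun_prop)]
  congr 1
  rw [Finset.mul_sum]
  refine Finset.sum_congr rfl fun k _ => ?_
  rw [intervalIntegral.integral_const_mul, integral_mul_one_sub_mul_sin]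
  field_simp
  ring

/-- Riemann-Lebesgue: the integral is the real part of a Fourier integral at frequency `K`. -/
theorem tendsto_integral_cos_mul {f : ℝ → ℝ} (hf : IntegrableOn f (Set.Ioo 0 1)) :
    Tendsto (fun K : ℕ => ∫ x in (0 : ℝ)..1, Real.cos (2 * π * (x * K)) * f x) atTop (nhds 0) := by
  let F : ℝ → ℂ := (Set.Ioo (0 : ℝ) 1).indicator fun x => (f x : ℂ)
  have hF : Integrable F := (integrable_indicator_iff measurableSet_Ioo).2 hf.ofReal
  have h := Real.tendsto_integral_exp_smul_cocompact F
  have hK : Tendsto (fun K : ℕ => (K : ℝ)) atTop (cocompact ℝ) :=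
    tendsto_natCast_atTop_atTop.mono_right atTop_le_cocompact
  have h2 := (Complex.continuous_re.tendsto 0).comp (h.comp hK)
  rw [Complex.zero_re] at h2
  refine h2.congr fun K => ?_
  have hint : Integrable (fun v : ℝ => Real.fourierChar (-(v * (K : ℝ))) • F v) := by
    have := (Real.fourierIntegral_convergent_iff (μ := volume) (f := F) (K : ℝ)).2 hF
    simpa [mul_comm] using this
  have hre := Complex.reCLM.integral_comp_comm hint
  simp only [Complex.reCLM_apply] at hre
  simp only [Function.comp_apply]
  rw [← hre, integral_of_le zero_le_one, integral_Ioc_eq_integral_Ioo,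
    ← MeasureTheory.integral_indicator measurableSet_Ioo]
  congr 1
  ext x
  by_cases hx : x ∈ Set.Ioo (0 : ℝ) 1
  · simp only [F, Set.indicator_of_mem hx, Circle.smul_def, Real.fourierChar_apply, smul_eq_mul,
      Complex.re_mul_ofReal, Complex.exp_ofReal_mul_I_re]
    rw [mul_neg, Real.cos_neg]
  · simp [F, Set.indicator_of_notMem hx]

theorem integral_sinKernel : ∫ x in (0 : ℝ)..1, sinKernel x = 7 / π ^ 2 * realZeta 3 := by
  have h1 := (((hasSum_odd_realZeta (k := 3) (by norm_num)).tendsto_sum_nat).const_mul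
    (8 / π ^ 2)).add (tendsto_integral_cos_mul integrableOn_sinKernel)
  have h2 := tendsto_nhds_unique
    (tendsto_const_nhds.congr fun K => integral_sinKernel_eq_sum_add K) h1
  rw [h2]
  ring

/-! ### Termwise integration -/

theorem integral_one_sub_mul_pow (b : ℝ) (m : ℕ) :
    ∫ x in (0 : ℝ)..b, (1 - x) * x ^ m = b ^ (m + 1) / (m + 1) - b ^ (m + 2) / (m + 2) := by
  have h : ∀ x : ℝ, (1 - x) * x ^ m = x ^ m - x ^ (m + 1) := fun x => by ring
  simp only [h]
  rw [intervalIntegral.integral_sub (by apply Continuous.intervalIntegrable; fun_prop)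
    (by apply Continuous.intervalIntegrable; fun_prop), integral_pow, integral_pow]
  push_cast
  rw [zero_pow (by omega), zero_pow (by omega)]
  ring

/-- Integrating the generating function of the values `η(2j)` against `1 - x` over `[0, b]`. -/
theorem hasSum_dirichletEta_integral {b : ℝ} (hb0 : 0 ≤ b) (hb1 : b ≤ 1)
    (hs : Summable fun j : ℕ => dirichletEta (2 * j + 2) *
      (b ^ (2 * j + 3) / (2 * j + 3) - b ^ (2 * j + 4) / (2 * j + 4))) :
    HasSum (fun j : ℕ => dirichletEta (2 * j + 2) *
      (b ^ (2 * j + 3) / (2 * j + 3) - b ^ (2 * j + 4) / (2 * j + 4)))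
      (((∫ x in (0 : ℝ)..b, sinKernel x) - (b - b ^ 2 / 2)) / 2) := by
  let F : ℕ → ℝ → ℝ := fun j x => dirichletEta (2 * j + 2) * ((1 - x) * x ^ (2 * j + 2))
  have hIoo {x : ℝ} (hx : x ∈ Set.Ioo 0 b) : x ∈ Set.Ioo (0 : ℝ) 1 := ⟨hx.1, hx.2.trans_le hb1⟩
  have hint (j : ℕ) : ∫ x in Set.Ioo 0 b, F j x = dirichletEta (2 * j + 2) *
      (b ^ (2 * j + 3) / (2 * j + 3) - b ^ (2 * j + 4) / (2 * j + 4)) := by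
    rw [← integral_Ioc_eq_integral_Ioo, ← integral_of_le hb0,
      intervalIntegral.integral_const_mul, integral_one_sub_mul_pow]
    push_cast
    ring_nf
  have hF (j : ℕ) : Integrable (F j) (volume.restrict (Set.Ioo 0 b)) := by
    have : IntervalIntegrable (F j) volume 0 b := by
      apply Continuous.intervalIntegrable
      fun_prop
    exact (intervalIntegrable_iff_integrableOn_Ioo_of_le hb0).1 this
  -- By nonnegativity the norm integrals are the terms themselves, so `hs` alone justifies the
  -- interchange, even for `b = 1`, where the power series diverges at the endpoint.
  have hnorm (j : ℕ) : ∫ x in Set.Ioo 0 b, ‖F j x‖ = ∫ x in Set.Ioo 0 b, F j x := by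
    refine setIntegral_congr_fun measurableSet_Ioo fun x hx => ?_
    exact Real.norm_of_nonneg (mul_nonneg (dirichletEta_nonneg (by omega))
      (mul_nonneg (by linarith [(hIoo hx).2]) (pow_nonneg hx.1.le _)))
  have h := hasSum_integral_of_summable_integral_norm hF
    (by simpa only [hnorm, hint] using hs)
  simp only [hint] at h
  have hval : ∫ x in Set.Ioo 0 b, ∑' j, F j x =
      ∫ x in Set.Ioo 0 b, (sinKernel x - (1 - x)) / 2 := by
    refine setIntegral_congr_fun measurableSet_Ioo fun x hx => ?_
    have := (hasSum_dirichletEta_mul_pow (hIoo hx).1 (hIoo hx).2).mul_left (1 - x)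
    have h2 := this.of_eq (g := fun j => F j x) (fun j => by dsimp only [F]; ring) rfl
    refine h2.tsum_eq.trans ?_
    rw [sinKernel]
    ring
  refine h.of_eq (fun _ => rfl) ?_
  have hk : IntervalIntegrable sinKernel volume 0 b :=
    intervalIntegrable_sinKernel.mono_set (by
      rw [Set.uIcc_of_le hb0, Set.uIcc_of_le zero_le_one]
      exact Set.Icc_subset_Icc le_rfl hb1)
  rw [hval, ← integral_Ioc_eq_integral_Ioo, ← integral_of_le hb0,
    intervalIntegral.integral_div, intervalIntegral.integral_sub hk
      (by apply Continuous.intervalIntegrable; fun_prop)]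
  congr 2
  have := integral_one_sub_mul_pow b 0
  norm_num at this
  rw [this]

/-! ### The two series for `ζ(3)` -/

theorem slowTerm_succ (j : ℕ) : slowTerm (j + 1) = dirichletEta (2 * j + 2) *
    ((1 : ℝ) ^ (2 * j + 3) / (2 * j + 3) - (1 : ℝ) ^ (2 * j + 4) / (2 * j + 4)) := by
  rw [slowTerm, show 2 * (j + 1) = 2 * j + 2 by ring]
  generalize dirichletEta (2 * j + 2) = e
  push_cast
  rw [show 2 * ((j : ℝ) + 1) + 1 = 2 * j + 3 by ring, show 2 * ((j : ℝ) + 1) + 2 = 2 * j + 4 by ring]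
  simp only [one_pow]
  field_simp
  ring

theorem rapidTerm_succ (j : ℕ) : rapidTerm (j + 1) = 2 * (dirichletEta (2 * j + 2) *
    ((1 / 2 : ℝ) ^ (2 * j + 3) / (2 * j + 3) - (1 / 2 : ℝ) ^ (2 * j + 4) / (2 * j + 4))) := by
  rw [rapidTerm, show 2 * (j + 1) = 2 * j + 2 by ring]
  generalize dirichletEta (2 * j + 2) = e
  push_cast
  rw [show 2 * ((j : ℝ) + 1) + 1 = 2 * j + 3 by ring,
    show 2 * ((j : ℝ) + 1) + 2 = 2 * j + 4 by ring,
    show 2 * ((j : ℝ) + 1) + 3 = 2 * j + 5 by ring, one_div_pow, one_div_pow,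
    show 2 * j + 2 + 1 = 2 * j + 3 by ring, pow_succ _ (2 * j + 3)]
  generalize (2 : ℝ) ^ (2 * j + 3) = p
  by_cases hp : p = 0
  · simp [hp]
  field_simp
  ring

theorem slowTerm_nonneg {j : ℕ} (hj : 1 ≤ j) : 0 ≤ slowTerm j :=
  mul_nonneg (by positivity) (dirichletEta_nonneg (by omega))

theorem rapidTerm_nonneg {j : ℕ} (hj : 1 ≤ j) : 0 ≤ rapidTerm j :=
  mul_nonneg (by positivity) (dirichletEta_nonneg (by omega))

theorem summable_slowTerm_succ : Summable fun j : ℕ => slowTerm (j + 1) := by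
  refine Summable.of_nonneg_of_le (fun j => slowTerm_nonneg (by omega)) (fun j => ?_)
    (summable_one_div_succ_pow le_rfl)
  rw [slowTerm, ← mul_one (1 / ((j : ℝ) + 1) ^ 2)]
  refine mul_le_mul ?_ ?_ (dirichletEta_nonneg (by omega)) (by positivity)
  · push_cast
    have : (0 : ℝ) ≤ j := j.cast_nonneg
    refine one_div_le_one_div_of_le (by positivity) ?_
    nlinarith
  · exact (dirichletEta_bounds (k := 2 * (j + 1)) (by omega)).2

theorem rapidTerm_le {N j : ℕ} (hN : 1 ≤ N) (hj : N ≤ j) :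
    rapidTerm j ≤ (2 * N + 3) / (2 * (2 * N + 1) * (2 * N + 2)) * (1 / 4) ^ j := by
  have h1 : (2 * (j : ℝ) + 3) / (2 * (2 * j + 1) * (2 * j + 2)) ≤
      (2 * N + 3) / (2 * (2 * N + 1) * (2 * N + 2)) := by
    have hNj : (N : ℝ) ≤ j := by exact_mod_cast hj
    -- This form makes the monotonicity in `t` visible.
    have e (t : ℝ) (ht : 0 ≤ t) : (2 * t + 3) / (2 * (2 * t + 1) * (2 * t + 2)) =
        1 / 2 * (1 / (2 * t + 1)) + 1 / 4 * (1 / ((2 * t + 1) * (t + 1))) := by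
      field_simp
      ring
    rw [e _ j.cast_nonneg, e _ N.cast_nonneg]
    gcongr
  calc rapidTerm j ≤ (2 * (j : ℝ) + 3) / (2 ^ (2 * j + 1) * (2 * (j : ℝ) + 1) * (2 * j + 2)) * 1 :=
        mul_le_mul_of_nonneg_left (dirichletEta_bounds (by omega)).2 (by positivity)
    _ = (2 * (j : ℝ) + 3) / (2 * (2 * j + 1) * (2 * j + 2)) * (1 / 4) ^ j := by
        rw [pow_succ, pow_mul, one_div_pow]
        norm_num
        field_simp
    _ ≤ _ := by gcongr

theorem le_rapidTerm {k j : ℕ} (hj : 1 ≤ j) (hk : k ≤ 2 * j) :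
    (2 * (j : ℝ) + 3) / (2 ^ (2 * j + 1) * (2 * (j : ℝ) + 1) * (2 * (j : ℝ) + 2)) *
      (1 - 1 / 2 ^ k) ≤ rapidTerm j := by
  refine mul_le_mul_of_nonneg_left ?_ (by positivity)
  refine le_trans ?_ (dirichletEta_bounds (by omega)).1
  gcongr
  norm_num

theorem summable_rapidTerm_succ : Summable fun j : ℕ => rapidTerm (j + 1) := by
  refine Summable.of_nonneg_of_le (fun j => rapidTerm_nonneg (by omega))
    (fun j => rapidTerm_le le_rfl (by omega)) (Summable.mul_left _ ?_)
  exact (summable_nat_add_iff 1).2 (summable_geometric_of_lt_one (by norm_num) (by norm_num))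

theorem hasSum_slowTerm_succ :
    HasSum (fun j : ℕ => slowTerm (j + 1)) (7 / 2 / π ^ 2 * realZeta 3 - 1 / 4) := by
  have h := hasSum_dirichletEta_integral zero_le_one le_rfl
    (summable_slowTerm_succ.congr slowTerm_succ)
  refine h.of_eq slowTerm_succ ?_
  rw [integral_sinKernel]
  ring

theorem hasSum_rapidTerm_succ :
    HasSum (fun j : ℕ => rapidTerm (j + 1)) (7 / 2 / π ^ 2 * realZeta 3 - 3 / 8) := by
  have h := (hasSum_dirichletEta_integral (b := 1 / 2) (by norm_num) (by norm_num)
    ((summable_mul_left_iff (two_ne_zero' ℝ)).1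
      (summable_rapidTerm_succ.congr rapidTerm_succ))).mul_left 2
  refine h.of_eq rapidTerm_succ ?_
  have h1 := integral_sinKernel_eq_two_mul
  rw [integral_sinKernel] at h1
  rw [show ∫ x in (0 : ℝ)..(1 / 2), sinKernel x = 7 / π ^ 2 * realZeta 3 / 2 by linarith]
  ring

/-! ### Tails of the rapid series and of `∑ 1/j^3` -/

theorem sum_Icc_one_eq_sum_range (f : ℕ → ℝ) (N : ℕ) :
    ∑ j ∈ Finset.Icc 1 N, f j = ∑ i ∈ Finset.range N, f (i + 1) := by
  induction N with
  | zero => simp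
  | succ N ih => rw [Finset.sum_Icc_succ_top (by omega), Finset.sum_range_succ, ih]

theorem hasSum_rapidTerm_tail (N : ℕ) :
    HasSum (fun j : ℕ => rapidTerm (j + N + 1))
      (7 / 2 / π ^ 2 * (realZeta 3 - rapidApprox N)) := by
  have h := (hasSum_nat_add_iff' N).2 hasSum_rapidTerm_succ
  refine h.of_eq (fun _ => rfl) ?_
  rw [rapidApprox, sum_Icc_one_eq_sum_range]
  field_simp
  ring

/-- `M = 1` gives a constant uniform in `N`; `M = N + 1` gives the sharpest one. -/
theorem realZeta_three_sub_rapidApprox_le {M N : ℕ} (hM : 1 ≤ M) (hMN : M ≤ N + 1) :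
    7 / 2 / π ^ 2 * (realZeta 3 - rapidApprox N) ≤
      (2 * M + 3) / (2 * (2 * M + 1) * (2 * M + 2)) * (4 / 3 * (1 / 4) ^ (N + 1)) := by
  have hg : HasSum (fun j : ℕ => (1 / 4 : ℝ) ^ (j + N + 1)) (4 / 3 * (1 / 4) ^ (N + 1)) := by
    have := (hasSum_geometric_of_lt_one (r := (1 / 4 : ℝ)) (by norm_num) (by norm_num)).mul_right
      ((1 / 4 : ℝ) ^ (N + 1))
    refine this.of_eq (fun j => ?_) (by norm_num)
    rw [← pow_add, add_assoc]
  exact hasSum_le (fun j => rapidTerm_le hM (by omega)) (hasSum_rapidTerm_tail N) (hg.mul_left _)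

theorem sum_rapidTerm_le_realZeta_three_sub (N m : ℕ) :
    ∑ j ∈ Finset.range m, rapidTerm (j + N + 1) ≤
      7 / 2 / π ^ 2 * (realZeta 3 - rapidApprox N) :=
  sum_le_hasSum _ (fun j _ => rapidTerm_nonneg (by omega)) (hasSum_rapidTerm_tail N)

theorem rapidApprox_le_realZeta_three (N : ℕ) : 0 ≤ realZeta 3 - rapidApprox N := by
  have h := sum_rapidTerm_le_realZeta_three_sub N 0
  rw [Finset.sum_range_zero] at h
  exact nonneg_of_mul_nonneg_right h (by positivity)

theorem hasSum_sub_succ {f : ℕ → ℝ} (hf : Antitone f) (h0 : Tendsto f atTop (nhds 0)) :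
    HasSum (fun n => f n - f (n + 1)) (f 0) := by
  rw [hasSum_iff_tendsto_nat_of_nonneg (fun n => sub_nonneg.2 (hf n.le_succ))]
  simp only [Finset.sum_range_sub']
  simpa using h0.const_sub (f 0)

/-- Telescopes. Cubic tails are bounded on both sides through `t^3 ≤ t(t+1)(t+2) ≤ (t+1)^3`. -/
theorem hasSum_one_div_mul_add_two {c : ℝ} (hc : 0 < c) :
    HasSum (fun n : ℕ => 1 / ((n + c) * (n + c + 1) * (n + c + 2))) (1 / (2 * c * (c + 1))) := by
  have hanti : Antitone fun n : ℕ => 1 / (2 * (n + c) * (n + c + 1)) := by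
    intro a b hab
    have : (a : ℝ) ≤ b := by exact_mod_cast hab
    dsimp only
    gcongr
  have hlim : Tendsto (fun n : ℕ => 1 / (2 * (n + c) * (n + c + 1))) atTop (nhds 0) := by
    refine squeeze_zero (fun n => by positivity) (fun n => ?_)
      (tendsto_one_div_add_atTop_nhds_zero_nat (𝕜 := ℝ) |>.const_mul (1 / (2 * c)) |>.trans
        (by simp))
    rw [div_mul_div_comm, one_mul]
    have : (0 : ℝ) ≤ n := n.cast_nonneg
    gcongr <;> linarith
  refine (hasSum_sub_succ hanti hlim).of_eq (fun n => ?_) (by simp)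
  push_cast
  have : (0 : ℝ) ≤ n := n.cast_nonneg
  rw [show (n : ℝ) + 1 + c = n + c + 1 by ring]
  field_simp
  ring

theorem hasSum_zetaThree_tail (N : ℕ) :
    HasSum (fun n : ℕ => 1 / ((n : ℝ) + N + 1) ^ 3) (realZeta 3 - zetaThreePartial N) := by
  have h := (hasSum_nat_add_iff' N).2 (hasSum_realZeta (k := 3) (by norm_num))
  refine h.of_eq (fun n => by push_cast; rfl) ?_
  rw [zetaThreePartial, sum_Icc_one_eq_sum_range (fun j => 1 / (j : ℝ) ^ 3)]
  push_cast
  rfl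

theorem le_realZeta_three_sub_zetaThreePartial (N : ℕ) :
    1 / (2 * ((N : ℝ) + 1) * (N + 2)) ≤ realZeta 3 - zetaThreePartial N := by
  have h := hasSum_one_div_mul_add_two (c := (N : ℝ) + 1) (by positivity)
  rw [add_assoc, one_add_one_eq_two] at h
  refine hasSum_le (fun n => ?_) h (hasSum_zetaThree_tail N)
  rw [← add_assoc]
  refine one_div_le_one_div_of_le (by positivity) ?_
  have : (0 : ℝ) ≤ (n : ℝ) + N + 1 := by positivity
  generalize (n : ℝ) + N + 1 = t at *
  nlinarith [mul_nonneg this this]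

theorem realZeta_three_sub_zetaThreePartial_le {N : ℕ} (hN : 1 ≤ N) :
    realZeta 3 - zetaThreePartial N ≤ 1 / (2 * (N : ℝ) * (N + 1)) := by
  have hN' : (0 : ℝ) < N := by exact_mod_cast hN
  refine hasSum_le (fun n => ?_) (hasSum_zetaThree_tail N) (hasSum_one_div_mul_add_two hN')
  refine one_div_le_one_div_of_le (by positivity) ?_
  have : (0 : ℝ) ≤ (n : ℝ) + N := by positivity
  generalize (n : ℝ) + N = t at *
  nlinarith

/-! ### Numerical bounds -/

theorem pi_sq_bounds : 9.869 < π ^ 2 ∧ π ^ 2 < 9.87 := by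
  have h1 := Real.pi_gt_d4
  have h2 := Real.pi_lt_d4
  constructor <;> nlinarith

theorem realZeta_three_sub_rapidApprox_eq (N : ℕ) :
    realZeta 3 - rapidApprox N =
      2 / 7 * π ^ 2 * (7 / 2 / π ^ 2 * (realZeta 3 - rapidApprox N)) := by
  field_simp

theorem realZeta_three_sub_rapidApprox_le_pow (N : ℕ) :
    realZeta 3 - rapidApprox N ≤ 1 / 4 ^ (N + 1) := by
  -- The constant is `5/24 · 4/3 = 5/18`, and `5/18 · 2π²/7 < 1`.
  have h := realZeta_three_sub_rapidApprox_le le_rfl (Nat.le_add_left 1 N)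
  rw [realZeta_three_sub_rapidApprox_eq]
  rw [one_div_pow] at h
  have hp : 0 < 1 / (4 : ℝ) ^ (N + 1) := by positivity
  generalize 1 / (4 : ℝ) ^ (N + 1) = q at h hp ⊢
  norm_num at h
  have := mul_le_mul_of_nonneg_left h (by positivity : 0 ≤ 2 / 7 * π ^ 2)
  nlinarith [pi_sq_bounds.2]

theorem realZeta_three_sub_rapidApprox_ten_le :
    realZeta 3 - rapidApprox 10 ≤ 1.99e-8 := by
  -- Term 11 is split off: one geometric bound from `j = 11` gives about `2.03e-8`, above the
  -- available `1/(2·5001·5002) ≈ 1.9988e-8`.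
  have h := realZeta_three_sub_rapidApprox_le (M := 12) (N := 11) (by norm_num) (by norm_num)
  have hr := rapidTerm_le (N := 11) (j := 11) (by norm_num) le_rfl
  have e : 7 / 2 / π ^ 2 * (realZeta 3 - rapidApprox 10) =
      7 / 2 / π ^ 2 * (realZeta 3 - rapidApprox 11) + rapidTerm 11 := by
    simp only [rapidApprox, Finset.sum_Icc_succ_top (show 1 ≤ 10 + 1 by norm_num)]
    field_simp
    ring
  rw [realZeta_three_sub_rapidApprox_eq, e]
  have := mul_le_mul_of_nonneg_left (add_le_add h hr) (by positivity : 0 ≤ 2 / 7 * π ^ 2)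
  refine this.trans ?_
  norm_num
  linarith [pi_sq_bounds.2]

theorem le_realZeta_three_sub_rapidApprox_ten :
    1.965e-8 ≤ realZeta 3 - rapidApprox 10 := by
  -- Terms 11 to 14 suffice to exceed `1/(2·5050·5051) ≈ 1.9602e-8`.
  have h := sum_rapidTerm_le_realZeta_three_sub 10 4
  have hr (j : ℕ) (hj : 11 ≤ j) := le_rapidTerm (k := 22) (j := j) (by omega) (by omega)
  have h0 := hr 11 (by norm_num)
  have h1 := hr 12 (by norm_num)
  have h2 := hr 13 (by norm_num)
  have h3 := hr 14 (by norm_num)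
  simp only [Finset.sum_range_succ, Finset.sum_range_zero] at h
  norm_num at h h0 h1 h2 h3
  rw [realZeta_three_sub_rapidApprox_eq]
  have := mul_le_mul_of_nonneg_left
    ((add_le_add (add_le_add (add_le_add h0 h1) h2) h3).trans h)
    (by positivity : 0 ≤ 2 / 7 * π ^ 2)
  refine le_trans ?_ this
  norm_num
  linarith [pi_sq_bounds.1]

theorem norm_riemannZeta_three_sub {a : ℝ} (ha : 0 ≤ realZeta 3 - a) :
    ‖riemannZeta 3 - (a : ℂ)‖ = realZeta 3 - a := by
  rw [riemannZeta_three_eq, ← Complex.ofReal_sub, Complex.norm_real, Real.norm_of_nonneg ha]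

theorem zetaThreePartial_le_realZeta_three (N : ℕ) : 0 ≤ realZeta 3 - zetaThreePartial N :=
  le_trans (by positivity) (le_realZeta_three_sub_zetaThreePartial N)

theorem mainTheorem6 :
    -- first series, `j` running over the positive integers
    (Summable (fun j : ℕ+ => slowTerm j) ∧
      riemannZeta 3 = ((2 / 7 * π ^ 2 * (1 / 4 + ∑' j : ℕ+, slowTerm j) : ℝ) : ℂ)) ∧
    -- second series
    (Summable (fun j : ℕ+ => rapidTerm j) ∧
      riemannZeta 3 = ((2 / 7 * π ^ 2 * (3 / 8 + ∑' j : ℕ+, rapidTerm j) : ℝ) : ℂ)) ∧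
    -- geometric convergence of the second series
    (∀ N : ℕ, ‖riemannZeta 3 - (rapidApprox N : ℂ)‖ ≤ 1 / 4 ^ (N + 1)) ∧
    -- ten terms of the second series are accurate to seven decimal places
    ‖riemannZeta 3 - (rapidApprox 10 : ℂ)‖ < 1 / 2 * (1 / 10 ^ 7) ∧
    -- and comparable to about 5000 terms of the defining series of `ζ(3)`
    ‖riemannZeta 3 - (rapidApprox 10 : ℂ)‖ ≤ ‖riemannZeta 3 - (zetaThreePartial 5000 : ℂ)‖ ∧
    ‖riemannZeta 3 - (zetaThreePartial 5050 : ℂ)‖ ≤ ‖riemannZeta 3 - (rapidApprox 10 : ℂ)‖ := by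
  have hslow := hasSum_pnat_iff_hasSum_succ.2 hasSum_slowTerm_succ
  have hrapid := hasSum_pnat_iff_hasSum_succ.2 hasSum_rapidTerm_succ
  refine ⟨⟨hslow.summable, ?_⟩, ⟨hrapid.summable, ?_⟩, fun N => ?_, ?_, ?_, ?_⟩
  · rw [hslow.tsum_eq, riemannZeta_three_eq]
    congr 1
    field_simp
    ring
  · rw [hrapid.tsum_eq, riemannZeta_three_eq]
    congr 1
    field_simp
    ring
  · rw [norm_riemannZeta_three_sub (rapidApprox_le_realZeta_three N)]
    exact realZeta_three_sub_rapidApprox_le_pow N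
  · rw [norm_riemannZeta_three_sub (rapidApprox_le_realZeta_three 10)]
    exact realZeta_three_sub_rapidApprox_ten_le.trans_lt (by norm_num)
  · rw [norm_riemannZeta_three_sub (rapidApprox_le_realZeta_three 10),
      norm_riemannZeta_three_sub (zetaThreePartial_le_realZeta_three 5000)]
    refine realZeta_three_sub_rapidApprox_ten_le.trans
      (le_trans ?_ (le_realZeta_three_sub_zetaThreePartial 5000))
    norm_num
  · rw [norm_riemannZeta_three_sub (rapidApprox_le_realZeta_three 10),
      norm_riemannZeta_three_sub (zetaThreePartial_le_realZeta_three 5050)]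
    refine (realZeta_three_sub_zetaThreePartial_le (by norm_num)).trans
      (le_trans ?_ le_realZeta_three_sub_rapidApprox_ten)
    norm_num
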